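/- Represent a partition of $n\ge 1$ by its Frobenius symbol $$\begin{pmatrix} x_1 & x_2 & \cdots & x_d\\ y_1 & y_2 & \cdots & y_d\end{pmatrix},$$ where $d$ is the number of dots on the main diagonal of its Ferrers graph, $x_i$ is the number of dots of row $i$ to the right of the diagonal, and $y_i$ is the number of dots of column $i$ below the diagonal. The column $(x_i,y_i)$ is called positive if $x_i-y_i\ge 1$ and negative if $x_i-y_i\le 0$. The parity blocks of the partition are the maximal runs of contiguous columns that are all positive (a positive block) or all negative (a negative block). For $m\ge1$ let $a^+_m(n)$ and $a^-_m(n)$ be the numbers of partitions of $n$ with exactly $m$ parity blocks whose last (rightmost) block is positive, respectively negative. Let $(q;q)_\infty=\prod_{i\ge1}(1-q^i)$, and let $p(k)$ be the number of partitions of $k$, with $p(k)=0$ for $k<0$. **Theorem.** Let $m\ge 1$. As formal power series in $q$, $$\sum_{n=1}^{\infty} a^+_m(n)\, q^n =(-1)^{m}+\frac{(-1)^{m-1}}{(q;q)_{\infty}} \sum_{l=0}^{m-1}(-1)^{l}q^{\frac{l(3l+1)}{2}}(1-q^{2l+1})$$ and $$\sum_{n=1}^{\infty} a^-_m(n)\,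 q^n =(-1)^{m}+\frac{(-1)^{m-1}}{(q;q)_{\infty}} \sum_{l=0}^{m-1}(-1)^{l}q^{\frac{l(3l-1)}{2}}(1-q^{4l+2}).$$ Equivalently, for all $n\ge 1$, $$a^+_m(n)=(-1)^{m-1}\sum_{l=0}^{m-1}(-1)^{l}\left( p\left(n-\frac{3l^2+l}{2}\right)-p\left(n-\frac{3(l+1)^2-(l+1)}{2}\right) \right)$$ and $$a^-_m(n)=(-1)^{m-1}\sum_{l=0}^{m-1}(-1)^{l}\left( p\left(n-\frac{3l^2-l}{2}\right)-p\left(n-\frac{3(l+1)^2+(l+1)}{2}\right) \right).$$ -/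

import Mathlib

namespace ParityBlocks

/-- The Ferrers graph of a partition: row `i` (counted from `0`) consists of the cells `(i, j)` with
`j` smaller than the `(i + 1)`-st largest part. -/
def ferrersGraph {n : ℕ} (p : n.Partition) : YoungDiagram :=
  YoungDiagram.ofRowLens (p.parts.sort (· ≥ ·)) (p.parts.pairwise_sort (· ≥ ·)).sortedGE

/-- The number of dots on the main diagonal of a Ferrers graph. -/
def diagonalLength (μ : YoungDiagram) : ℕ :=
  (μ.cells.filter fun c => c.1 = c.2).card

/-- The Frobenius symbol of a Ferrers graph, as the list of its columns `(x, y)`: `x` is the number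
of dots to the right of a diagonal dot in its row, `y` is the number of dots below it in its
column. The subtractions do not truncate, since `i` runs over the diagonal dots `(i, i)`. -/
def frobeniusSymbol (μ : YoungDiagram) : List (ℕ × ℕ) :=
  (List.range (diagonalLength μ)).map fun i => (μ.rowLen i - (i + 1), μ.colLen i - (i + 1))

/-- A column `(x, y)` of a Frobenius symbol is positive if `x - y ≥ 1`. -/
def ColumnPositive (c : ℕ × ℕ) : Prop := (c.1 : ℤ) - c.2 ≥ 1

/-- A column `(x, y)` of a Frobenius symbol is negative if `x - y ≤ 0`. -/
def ColumnNegative (c : ℕ × ℕ) : Prop := (c.1 : ℤ) - c.2 ≤ 0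

instance : DecidablePred ColumnPositive := fun c => inferInstanceAs (Decidable ((c.1 : ℤ) - c.2 ≥ 1))

instance : DecidablePred ColumnNegative := fun c => inferInstanceAs (Decidable ((c.1 : ℤ) - c.2 ≤ 0))

/-- Two columns have the same parity if they are both positive or both negative. -/
def SameParity (c c' : ℕ × ℕ) : Prop :=
  (ColumnPositive c ∧ ColumnPositive c') ∨ (ColumnNegative c ∧ ColumnNegative c')

instance (c c' : ℕ × ℕ) : Decidable (SameParity c c') :=
  inferInstanceAs (Decidable
    ((ColumnPositive c ∧ ColumnPositive c') ∨ (ColumnNegative c ∧ ColumnNegative c')))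

/-- The parity blocks of a partition, from left to right: the maximal runs of contiguous columns of
its Frobenius symbol that have the same parity. -/
def parityBlocks {n : ℕ} (p : n.Partition) : List (List (ℕ × ℕ)) :=
  (frobeniusSymbol (ferrersGraph p)).splitBy fun c c' => decide (SameParity c c')

/-- The last parity block exists and consists of positive columns. -/
def LastBlockPositive {n : ℕ} (p : n.Partition) : Prop :=
  ∃ B ∈ (parityBlocks p).getLast?, ∀ c ∈ B, ColumnPositive c

/-- The last parity block exists and consists of negative columns. -/
def LastBlockNegative {n : ℕ} (p : n.Partition) : Prop :=
  ∃ B ∈ (parityBlocks p).getLast?, ∀ c ∈ B, ColumnNegative c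

/-- `a⁺_m(n)`: the number of partitions of `n` with exactly `m` parity blocks, the last of which is
positive. -/
noncomputable def aPos (m n : ℕ) : ℕ :=
  Nat.card {p : n.Partition // (parityBlocks p).length = m ∧ LastBlockPositive p}

/-- `a⁻_m(n)`: the number of partitions of `n` with exactly `m` parity blocks, the last of which is
negative. -/
noncomputable def aNeg (m n : ℕ) : ℕ :=
  Nat.card {p : n.Partition // (parityBlocks p).length = m ∧ LastBlockNegative p}

/-- The partition function on the integers, `p(k) = 0` for `k < 0`. -/
def partitionCount (k : ℤ) : ℤ :=
  if 0 ≤ k then (Fintype.card (Nat.Partition k.toNat) : ℤ) else 0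

open scoped PowerSeries.WithPiTopology in
/-- `(q; q)_∞ = ∏_{i ≥ 1} (1 - q ^ i)` as a formal power series in `q = X`. -/
noncomputable def qqInfinity : PowerSeries ℚ :=
  ∏' i : ℕ, (1 - PowerSeries.X ^ (i + 1))

/-- The generating function `∑_{n ≥ 1} a(n) q ^ n` of a sequence, without a constant term. -/
noncomputable def genSeries (a : ℕ → ℕ) : PowerSeries ℚ :=
  PowerSeries.mk fun n => if 1 ≤ n then (a n : ℚ) else 0

end ParityBlocks

/-!
A Frobenius symbol is a pair `(X, Y)` of finite sets of natural numbers with `#X = #Y`. For an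
arbitrary pair call `#X - #Y` the charge, and remove the entries of `X` and `Y` in decreasing order.
A positive column is completed by an entry of `X` that is removed at a charge `≤ 0`, a negative
column by an entry of `Y` that is removed at a charge `≥ 0`, so the charge passes zero between two
columns of opposite signs. At that moment the remaining pair may be reflected, by the symmetry
`d ↦ -d` or `d ↦ 1 - d` of the numbers of pairs of charge `d`. As in the reflection principle for
lattice paths, this turns the symbols of weight `n` with an alternating subsequence of `j` columns
of prescribed last sign into the pairs of weight `n - s` and of some charge `c`, and there are
`p(n - ω)` of those, with `ω` a pentagonal number. Two such counts differ by the number of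
partitions of `n` with exactly `l` or `l + 1` parity blocks of which the last has a given sign, and
an alternating sum over `l` isolates `m` blocks.
-/

namespace ParityBlocks

open Finset

/-! ### Alternating subsequences of sign sequences -/

/-- The length of the longest alternating subsequence of a list of signs that starts with the sign
`e`, computed greedily: wait for `e`, then for its opposite, and so on. -/
def oscillation : Bool → List Bool → ℕ
  | _, [] => 0
  | e, s :: T => if s = e then oscillation (!e) T + 1 else oscillation e T

/-- The first sign of the alternating word of length `j` that ends with `δ`; for `j = 0` it is the
opposite of `δ`, so that prepending the opposite sign always lengthens the word by one. -/
def startSign : ℕ → Bool → Bool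
  | 0, δ => !δ
  | j + 1, δ => !startSign j δ

lemma startSign_not (j : ℕ) (δ : Bool) : startSign j (!δ) = !startSign j δ := by
  induction j with
  | zero => rfl
  | succ j ih => simp only [startSign, ih]

lemma startSign_succ_not (j : ℕ) (δ : Bool) : startSign (j + 1) (!δ) = startSign j δ := by
  simp only [startSign, startSign_not, Bool.not_not]

lemma oscillation_cons_self (e : Bool) (T : List Bool) :
    oscillation e (e :: T) = oscillation (!e) T + 1 := if_pos rfl

lemma oscillation_not_cons (e : Bool) (T : List Bool) :
    oscillation (!e) (e :: T) = oscillation (!e) T := if_neg (by simp)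

lemma oscillation_replicate_append (e s : Bool) (k : ℕ) (T : List Bool) :
    oscillation e (List.replicate (k + 1) s ++ T) = oscillation e (s :: T) := by
  induction k generalizing e with
  | zero => rfl
  | succ k ih =>
    rw [List.replicate_succ, List.cons_append]
    obtain rfl | rfl : s = e ∨ e = !s := by cases s <;> cases e <;> simp
    · rw [oscillation_cons_self, ih, oscillation_not_cons, oscillation_cons_self]
    · rw [oscillation_not_cons, ih]

lemma oscillation_flatten {α : Type*} {f : α → Bool} {g : List α → Bool} {L : List (List α)}
    (hL : [] ∉ L) (hfg : ∀ B ∈ L, ∀ c ∈ B, f c = g B) (e : Bool) :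
    oscillation e (L.flatten.map f) = oscillation e (L.map g) := by
  induction L generalizing e with
  | nil => rfl
  | cons B L ih =>
    obtain ⟨hB, hL⟩ : [] ≠ B ∧ [] ∉ L := by simpa using hL
    have hBf : B.map f = List.replicate (B.length - 1 + 1) (g B) := by
      rw [Nat.sub_add_cancel (List.length_pos_of_ne_nil hB.symm), List.eq_replicate_iff]
      simpa using hfg B List.mem_cons_self
    have ih := ih hL fun B' hB' ↦ hfg B' (List.mem_cons_of_mem B hB')
    rw [List.flatten_cons, List.map_append, hBf, oscillation_replicate_append, List.map_cons,
      oscillation, oscillation, ih, ih]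

lemma oscillation_of_isChain {s : Bool} {T : List Bool} (hT : (s :: T).IsChain (· ≠ ·)) :
    oscillation s (s :: T) = T.length + 1 ∧ oscillation (!s) (s :: T) = T.length := by
  induction T generalizing s with
  | nil => simp [oscillation]
  | cons t T ih =>
    obtain ⟨hst, hT'⟩ := List.isChain_cons_cons.1 hT
    obtain rfl : s = !t := Bool.eq_not_of_ne hst
    rw [oscillation_cons_self, oscillation_not_cons, Bool.not_not, (ih hT').1]
    simp

lemma getLastD_eq_iff_of_isChain {s : Bool} {T : List Bool} (hT : (s :: T).IsChain (· ≠ ·))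
    (δ : Bool) : (s :: T).getLastD δ = δ ↔ s = startSign (T.length + 1) δ := by
  induction T generalizing s with
  | nil => simp [startSign]
  | cons t T ih =>
    obtain ⟨hst, hT'⟩ := List.isChain_cons_cons.1 hT
    obtain rfl : s = !t := Bool.eq_not_of_ne hst
    rw [List.length_cons, startSign, Bool.not_inj_iff, ← ih hT']
    simp

lemma oscillation_startSign_eq_iff {T : List Bool} (hT : T.IsChain (· ≠ ·)) (j : ℕ) (δ : Bool) :
    oscillation (startSign j δ) T = j ↔
      T.getLastD δ = δ ∧ (T.length = j ∨ T.length = j + 1) := by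
  cases T with
  | nil => simp [oscillation, eq_comm]
  | cons s T =>
    obtain ⟨hself, hnot⟩ := oscillation_of_isChain hT
    rw [getLastD_eq_iff_of_isChain hT, List.length_cons, Nat.add_right_cancel_iff]
    obtain hs | hs : startSign j δ = s ∨ startSign j δ = !s := by
      cases startSign j δ <;> cases s <;> simp
    · rw [hs, hself]
      refine ⟨fun h ↦ ⟨h ▸ hs.symm, .inl h⟩, fun ⟨hs', h⟩ ↦ h.resolve_right ?_⟩
      rintro rfl
      simp [startSign, hs] at hs'
    · rw [hs, hnot]
      refine ⟨fun h ↦ ⟨by simp [h, startSign, hs], .inr h⟩, fun ⟨hs', h⟩ ↦ h.resolve_left ?_⟩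
      intro h
      simp [h, hs] at hs'

/-! ### Pairs of finite sets -/

section

variable {k : ℕ} {X Y : Finset ℕ}

/-- The charge `#X - #Y` of a pair `(X, Y)` of finite sets. The Frobenius symbols with rows `X` and
`Y` are the pairs of charge zero. -/
def charge (p : Finset ℕ × Finset ℕ) : ℤ := #p.1 - #p.2

/-- The weight of a pair `(X, Y)` of finite sets: the elements of `Y` count one more than their
value, so that the weight of a Frobenius symbol is the number that is partitioned. -/
def pairWeight (p : Finset ℕ × Finset ℕ) : ℤ := ∑ x ∈ p.1, (x : ℤ) + ∑ y ∈ p.2, ((y : ℤ) + 1)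

lemma charge_insert_left (hk : k ∉ X) : charge (insert k X, Y) = charge (X, Y) + 1 := by
  simp only [charge, card_insert_of_notMem hk]
  push_cast
  ring

lemma charge_insert_right (hk : k ∉ Y) : charge (X, insert k Y) = charge (X, Y) - 1 := by
  simp only [charge, card_insert_of_notMem hk]
  push_cast
  ring

lemma charge_swap (p : Finset ℕ × Finset ℕ) : charge p.swap = -charge p := by
  simp [charge]

lemma pairWeight_swap (p : Finset ℕ × Finset ℕ) :
    pairWeight p.swap = pairWeight p + charge p := by
  simp only [pairWeight, charge, sum_add_distrib, sum_const, nsmul_eq_mul, Prod.fst_swap,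
    Prod.snd_swap]
  ring

lemma pairWeight_insert_left (hk : k ∉ X) :
    pairWeight (insert k X, Y) = pairWeight (X, Y) + k := by
  simp only [pairWeight, sum_insert hk]
  ring

lemma pairWeight_insert_right (hk : k ∉ Y) :
    pairWeight (X, insert k Y) = pairWeight (X, Y) + (k + 1) := by
  simp only [pairWeight, sum_insert hk]
  ring

lemma pairWeight_nonneg (p : Finset ℕ × Finset ℕ) : 0 ≤ pairWeight p := by
  unfold pairWeight
  positivity

end

/-- The pairs `(X, Y)` of charge `d` and weight `n` with `X ⊆ {0, …, k - 1}` and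
`Y ⊆ {0, …, l - 1}`. -/
def chargedPairs (k l : ℕ) (d n : ℤ) : Finset (Finset ℕ × Finset ℕ) :=
  {p ∈ (range k).powerset ×ˢ (range l).powerset | charge p = d ∧ pairWeight p = n}

lemma mem_chargedPairs {k l : ℕ} {d n : ℤ} {p : Finset ℕ × Finset ℕ} :
    p ∈ chargedPairs k l d n ↔
      (p.1 ⊆ range k ∧ p.2 ⊆ range l) ∧ charge p = d ∧ pairWeight p = n := by
  simp only [chargedPairs, mem_filter, mem_product, mem_powerset]

section

variable (P : Finset ℕ × Finset ℕ → Prop) [DecidablePred P] (k l : ℕ) (d n : ℤ)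

lemma card_filter_chargedPairs : #{p ∈ chargedPairs k l d n | P p} =
    ∑ X ∈ (range k).powerset, ∑ Y ∈ (range l).powerset,
      if (charge (X, Y) = d ∧ pairWeight (X, Y) = n) ∧ P (X, Y) then 1 else 0 := by
  rw [chargedPairs, filter_filter, card_filter, sum_product]

lemma card_filter_chargedPairs_succ_left :
    #{p ∈ chargedPairs (k + 1) l d n | P p} = #{p ∈ chargedPairs k l d n | P p} +
      #{p ∈ chargedPairs k l (d - 1) (n - k) | P (insert k p.1, p.2)} := by
  simp only [card_filter_chargedPairs, range_add_one (n := k),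
    sum_powerset_insert notMem_range_self]
  congr 1
  refine sum_congr rfl fun X hX ↦ sum_congr rfl fun Y _ ↦ ?_
  have hk : k ∉ X := fun h ↦ notMem_range_self (mem_powerset.1 hX h)
  rw [charge_insert_left hk, pairWeight_insert_left hk]
  simp only [eq_sub_iff_add_eq]

lemma card_filter_chargedPairs_succ_right :
    #{p ∈ chargedPairs k (l + 1) d n | P p} = #{p ∈ chargedPairs k l d n | P p} +
      #{p ∈ chargedPairs k l (d + 1) (n - (l + 1)) | P (p.1, insert l p.2)} := by
  simp only [card_filter_chargedPairs, range_add_one (n := l),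
    sum_powerset_insert notMem_range_self, sum_add_distrib]
  congr 1
  refine sum_congr rfl fun X _ ↦ sum_congr rfl fun Y hY ↦ ?_
  have hl : l ∉ Y := fun h ↦ notMem_range_self (mem_powerset.1 hY h)
  rw [charge_insert_right hl, pairWeight_insert_right hl]
  simp only [eq_sub_iff_add_eq, sub_eq_iff_eq_add]

end

/-- The number of pairs `(X, Y)` of charge `d` and weight `n` with `X ⊆ {0, …, k - 1}` and
`Y ⊆ {0, …, l - 1}`. -/
def pairCount (k l : ℕ) (d n : ℤ) : ℕ := #(chargedPairs k l d n)

lemma pairCount_succ_left (k l : ℕ) (d n : ℤ) :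
    pairCount (k + 1) l d n = pairCount k l d n + pairCount k l (d - 1) (n - k) := by
  simpa [pairCount] using card_filter_chargedPairs_succ_left (fun _ ↦ True) k l d n

lemma pairCount_succ_right (k l : ℕ) (d n : ℤ) :
    pairCount k (l + 1) d n = pairCount k l d n + pairCount k l (d + 1) (n - (l + 1)) := by
  simpa [pairCount] using card_filter_chargedPairs_succ_right (fun _ ↦ True) k l d n

lemma pairCount_zero_zero (d n : ℤ) : pairCount 0 0 d n = if d = 0 ∧ n = 0 then 1 else 0 := by
  simp only [pairCount, chargedPairs, range_zero, powerset_empty, product_singleton,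
    map_singleton, filter_singleton]
  split_ifs <;> simp_all [charge, pairWeight, eq_comm]

lemma pairCount_swap (k l : ℕ) (d n : ℤ) : pairCount k l d n = pairCount l k (-d) (n + d) := by
  refine card_equiv (Equiv.prodComm _ _) fun p ↦ ?_
  rw [Equiv.prodComm_apply, mem_chargedPairs, mem_chargedPairs, charge_swap, pairWeight_swap,
    and_comm (a := p.1 ⊆ _)]
  grind

lemma pairCount_shift (k l : ℕ) (d n : ℤ) :
    pairCount k (l + 1) d n = pairCount (k + 1) l (d + 1) (n + d) := by
  induction k generalizing d n with
  | zero =>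
    induction l generalizing d n with
    | zero =>
      simp only [pairCount_succ_left, pairCount_succ_right, pairCount_zero_zero]
      grind
    | succ l ih =>
      rw [pairCount_succ_right, pairCount_succ_right 1, ih, ih]
      push_cast
      ring_nf
  | succ k ih =>
    rw [pairCount_succ_left, pairCount_succ_left (k + 1), ih, ih]
    push_cast
    ring_nf

lemma pairCount_reflect (k : ℕ) (d n : ℤ) :
    pairCount (k + 1) k d n = pairCount (k + 1) k (1 - d) n := by
  rw [pairCount_swap, pairCount_shift]
  ring_nf

/-! ### The reflection principle -/

/-- The sign of a column of a Frobenius symbol: `true` if it is positive, `false` if it is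
negative. -/
def columnSign (c : ℕ × ℕ) : Bool := decide (c.2 < c.1)

lemma zip_concat_of_length_le {α β : Type*} {A : List α} {B : List β} (h : B.length ≤ A.length)
    (a : α) : (A ++ [a]).zip B = A.zip B := by
  apply List.ext_getElem <;> grind

lemma zip_concat_of_length_lt {α β : Type*} {A : List α} {B : List β} (h : A.length < B.length)
    (a : α) : (A ++ [a]).zip B = A.zip B ++ [(a, B[A.length])] := by
  apply List.ext_getElem <;> grind

lemma sort_insert_of_forall_lt {α : Type*} [LinearOrder α] {k : α} {X : Finset α}
    (hX : ∀ x ∈ X, x < k) : (insert k X).sort = X.sort ++ [k] := by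
  have hsorted : (X.sort ++ [k]).SortedLT := by
    refine List.Pairwise.sortedLT (List.pairwise_append.2
      ⟨X.sortedLT_sort.pairwise, List.pairwise_singleton _ _, ?_⟩)
    simpa using hX
  rw [← (List.toFinset_sort (· ≤ ·) hsorted.nodup).2 hsorted.sortedLE.pairwise]
  congr 1
  ext
  simp

/-- The columns of the two-rowed array with the rows `X` and `Y`, both in decreasing order and
aligned at their right ends; the overhanging entries of the longer row are dropped. -/
def columns (p : Finset ℕ × Finset ℕ) : List (ℕ × ℕ) := (p.1.sort.zip p.2.sort).reverse

lemma columns_swap (p : Finset ℕ × Finset ℕ) : columns p.swap = (columns p).map Prod.swap := by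
  simp [columns, List.map_reverse, List.zip_swap]

section

variable {k : ℕ} {X Y : Finset ℕ}

lemma columns_insert_left_of_card_le (hX : ∀ x ∈ X, x < k) (h : #Y ≤ #X) :
    columns (insert k X, Y) = columns (X, Y) := by
  simp only [columns, sort_insert_of_forall_lt hX]
  rw [zip_concat_of_length_le (by simpa)]

lemma columns_insert_left_of_card_lt (hX : ∀ x ∈ X, x < k) (h : #X < #Y) :
    ∃ y ∈ Y, columns (insert k X, Y) = (k, y) :: columns (X, Y) := by
  refine ⟨Y.sort[X.sort.length]'(by simpa), (mem_sort _).1 (List.getElem_mem _), ?_⟩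
  simp only [columns, sort_insert_of_forall_lt hX]
  rw [zip_concat_of_length_lt (by simpa), List.reverse_append, List.reverse_singleton,
    List.singleton_append]

lemma columns_insert_right_of_card_le (hY : ∀ y ∈ Y, y < k) (h : #X ≤ #Y) :
    columns (X, insert k Y) = columns (X, Y) := by
  have := columns_swap (insert k Y, X)
  rwa [columns_insert_left_of_card_le hY h, ← columns_swap] at this

lemma columns_insert_right_of_card_lt (hY : ∀ y ∈ Y, y < k) (h : #Y < #X) :
    ∃ x ∈ X, columns (X, insert k Y) = (x, k) :: columns (X, Y) := by
  obtain ⟨x, hx, h⟩ := columns_insert_left_of_card_lt hY h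
  have := columns_swap (insert k Y, X)
  rw [h, List.map_cons, ← columns_swap] at this
  exact ⟨x, hx, this⟩

end

/-- The signs of the columns of a pair of finite sets. -/
def columnSigns (p : Finset ℕ × Finset ℕ) : List Bool := (columns p).map columnSign

section

variable {k : ℕ} {X Y : Finset ℕ}

lemma columnSigns_insert_left (hX : X ⊆ range k) (hY : Y ⊆ range k) :
    columnSigns (insert k X, Y) =
      if charge (X, Y) < 0 then true :: columnSigns (X, Y) else columnSigns (X, Y) := by
  have hX' : ∀ x ∈ X, x < k := fun x hx ↦ mem_range.1 (hX hx)
  have hcharge : charge (X, Y) < 0 ↔ #X < #Y := by simp [charge]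
  simp only [hcharge, columnSigns]
  split_ifs with h
  · obtain ⟨y, hy, hcol⟩ := columns_insert_left_of_card_lt hX' h
    simpa [hcol, columnSign] using hY hy
  · rw [columns_insert_left_of_card_le hX' (not_lt.1 h)]

lemma columnSigns_insert_right (hX : X ⊆ range (k + 1)) (hY : Y ⊆ range k) :
    columnSigns (X, insert k Y) =
      if 0 < charge (X, Y) then false :: columnSigns (X, Y) else columnSigns (X, Y) := by
  have hY' : ∀ y ∈ Y, y < k := fun y hy ↦ mem_range.1 (hY hy)
  have hcharge : 0 < charge (X, Y) ↔ #Y < #X := by simp [charge]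
  simp only [hcharge, columnSigns]
  split_ifs with h
  · obtain ⟨x, hx, hcol⟩ := columns_insert_right_of_card_lt hY' h
    simpa [hcol, columnSign, Nat.lt_succ_iff] using hX hx
  · rw [columns_insert_right_of_card_le hY' (not_lt.1 h)]

end

/-- The number of pairs in `chargedPairs k l d n` whose column signs have an alternating
subsequence of length `j` that starts with `e`. -/
def oscillationCount (k l : ℕ) (d n : ℤ) (j : ℕ) (e : Bool) : ℕ :=
  #{p ∈ chargedPairs k l d n | j ≤ oscillation e (columnSigns p)}

lemma oscillationCount_zero (k l : ℕ) (d n : ℤ) (e : Bool) :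
    oscillationCount k l d n 0 e = pairCount k l d n := by
  simp [oscillationCount, pairCount]

lemma oscillationCount_zero_zero (d n : ℤ) (j : ℕ) (e : Bool) :
    oscillationCount 0 0 d n (j + 1) e = 0 := by
  simp only [oscillationCount, card_eq_zero, filter_eq_empty_iff, mem_chargedPairs, range_zero,
    subset_empty]
  rintro ⟨X, Y⟩ ⟨⟨rfl, rfl⟩, -⟩
  simp [columnSigns, columns, oscillation]

section

variable (k : ℕ) {d : ℤ} (n : ℤ) (j : ℕ) (e : Bool)

lemma oscillationCount_succ_left (h : 0 < d ∨ e = false) :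
    oscillationCount (k + 1) k d n j e =
      oscillationCount k k d n j e + oscillationCount k k (d - 1) (n - k) j e := by
  rw [oscillationCount, card_filter_chargedPairs_succ_left]
  congr 2
  refine filter_congr fun p hp ↦ ?_
  obtain ⟨⟨hX, hY⟩, hd, -⟩ := mem_chargedPairs.1 hp
  rw [columnSigns_insert_left hX hY]
  split_ifs with hneg
  · obtain rfl : e = !true := h.resolve_left (by grind)
    rw [oscillation_not_cons]
  · rfl

lemma oscillationCount_succ_left_of_charge_zero :
    oscillationCount (k + 1) k 0 n (j + 1) true =
      oscillationCount k k 0 n (j + 1) true + oscillationCount k k (-1) (n - k) j false := by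
  rw [oscillationCount, card_filter_chargedPairs_succ_left, zero_sub]
  congr 2
  refine filter_congr fun p hp ↦ ?_
  obtain ⟨⟨hX, hY⟩, hd, -⟩ := mem_chargedPairs.1 hp
  rw [columnSigns_insert_left hX hY, if_pos (hd.trans_lt neg_one_lt_zero), oscillation_cons_self,
    Nat.add_le_add_iff_right, Bool.not_true]

lemma oscillationCount_succ_right (h : d < 0 ∨ e = true) :
    oscillationCount (k + 1) (k + 1) d n j e =
      oscillationCount (k + 1) k d n j e +
        oscillationCount (k + 1) k (d + 1) (n - (k + 1)) j e := by
  rw [oscillationCount, card_filter_chargedPairs_succ_right]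
  congr 2
  refine filter_congr fun p hp ↦ ?_
  obtain ⟨⟨hX, hY⟩, hd, -⟩ := mem_chargedPairs.1 hp
  rw [columnSigns_insert_right hX hY]
  split_ifs with hpos
  · obtain rfl : e = !false := h.resolve_left (by grind)
    rw [oscillation_not_cons]
  · rfl

lemma oscillationCount_succ_right_of_charge_zero :
    oscillationCount (k + 1) (k + 1) 0 n (j + 1) false =
      oscillationCount (k + 1) k 0 n (j + 1) false +
        oscillationCount (k + 1) k 1 (n - (k + 1)) j true := by
  rw [oscillationCount, card_filter_chargedPairs_succ_right, zero_add]
  congr 2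
  refine filter_congr fun p hp ↦ ?_
  obtain ⟨⟨hX, hY⟩, hd, -⟩ := mem_chargedPairs.1 hp
  rw [columnSigns_insert_right hX hY, if_pos (zero_lt_one.trans_eq hd.symm),
    oscillation_cons_self, Nat.add_le_add_iff_right, Bool.not_false]

end

/-- The charge that is reached from charge zero by the `j` successive reflections of the pairs with
an alternating subsequence of length `j` that starts with `e`. -/
def reflectedCharge : ℕ → Bool → ℤ
  | 0, _ => 0
  | j + 1, true => 2 - reflectedCharge j false
  | j + 1, false => -1 - reflectedCharge j true

/-- The weight that is lost in the reflections behind `reflectedCharge`. -/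
def reflectedShift : ℕ → Bool → ℤ
  | 0, _ => 0
  | j + 1, true => reflectedShift j false + reflectedCharge (j + 1) true - 1
  | j + 1, false => reflectedShift j true

/-- The reflection principle for pairs with entries below `k` and `l`. If the entries are removed in
decreasing order, starting from a charge `d` on the stated side of zero, then a column of sign `e`
appears only when the charge leaves zero, and there the remaining pair can be reflected; so the
pairs with an alternating subsequence of length `j` that starts with `e` are equinumerous with all
the pairs of the reflected charge and weight. -/
def ReflectsAt (k l : ℕ) : Prop :=
  ∀ (d n : ℤ) (j : ℕ) (e : Bool), (if e then 0 ≤ d else d ≤ 0) →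
    oscillationCount k l d n j e =
      pairCount k l (d + reflectedCharge j e) (n - reflectedShift j e)

lemma reflectedCharge_nonneg_nonpos (j : ℕ) :
    0 ≤ reflectedCharge j true ∧ reflectedCharge j false ≤ 0 := by
  induction j with
  | zero => simp [reflectedCharge]
  | succ j ih =>
    simp only [reflectedCharge]
    omega

lemma reflectsAt_zero : ReflectsAt 0 0 := by
  rintro d n (_ | j) e hd
  · simp [oscillationCount_zero, reflectedCharge, reflectedShift]
  · rw [oscillationCount_zero_zero, pairCount_zero_zero, if_neg]
    have := reflectedCharge_nonneg_nonpos j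
    cases e <;> grind [reflectedCharge]

lemma ReflectsAt.succ_left {k : ℕ} (h : ReflectsAt k k) : ReflectsAt (k + 1) k := by
  rintro d n (_ | j) e hd
  · simp [oscillationCount_zero, reflectedCharge, reflectedShift]
  rw [pairCount_succ_left]
  by_cases hde : 0 < d ∨ e = false
  · rw [oscillationCount_succ_left k n _ e hde, h d n _ e hd, h (d - 1) _ _ e (by grind)]
    ring_nf
  · obtain ⟨rfl, rfl⟩ : d = 0 ∧ e = true := by grind
    rw [oscillationCount_succ_left_of_charge_zero, h 0 n _ true hd, h (-1) _ j false (by simp),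
      pairCount_swap k k (-1 + _)]
    simp only [reflectedCharge, reflectedShift]
    ring_nf

lemma ReflectsAt.succ_right {k : ℕ} (h : ReflectsAt (k + 1) k) : ReflectsAt (k + 1) (k + 1) := by
  rintro d n (_ | j) e hd
  · simp [oscillationCount_zero, reflectedCharge, reflectedShift]
  rw [pairCount_succ_right]
  by_cases hde : d < 0 ∨ e = true
  · rw [oscillationCount_succ_right k n _ e hde, h d n _ e hd, h (d + 1) _ _ e (by grind)]
    ring_nf
  · obtain ⟨rfl, rfl⟩ : d = 0 ∧ e = false := by grind
    rw [oscillationCount_succ_right_of_charge_zero, h 0 n _ false hd, h 1 _ j true (by simp),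
      pairCount_reflect k (1 + _)]
    simp only [reflectedCharge, reflectedShift]
    ring_nf

theorem reflectsAt_self (k : ℕ) : ReflectsAt k k := by
  induction k with
  | zero => exact reflectsAt_zero
  | succ k ih => exact ih.succ_left.succ_right

/-! ### Ferrers graphs and Frobenius symbols -/

section

variable {μ : YoungDiagram} {i j : ℕ}

lemma diag_mem_iff : (i, i) ∈ μ ↔ i < diagonalLength μ := by
  obtain ⟨D, hD⟩ : ∃ D, ∀ i, (i, i) ∈ μ ↔ i < D := by
    have hex : ∃ D, (D, D) ∉ μ := by
      obtain ⟨j, hj⟩ := μ.exists_notMem_row 0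
      exact ⟨j, fun h ↦ hj (μ.up_left_mem (Nat.zero_le _) le_rfl h)⟩
    exact ⟨Nat.find hex, fun i ↦
      ⟨fun h ↦ not_le.1 fun hle ↦ Nat.find_spec hex (μ.up_left_mem hle hle h),
        fun h ↦ not_not.1 (Nat.find_min hex h)⟩⟩
  have hdiag : {c ∈ μ.cells | c.1 = c.2} = (range D).image fun i ↦ (i, i) := by
    ext ⟨a, b⟩
    simp only [mem_filter, YoungDiagram.mem_cells, mem_image, mem_range, Prod.mk.injEq, ← hD]
    grind
  rw [hD, diagonalLength, hdiag, card_image_of_injective _ fun a b h ↦ congrArg Prod.fst h,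
    card_range]

lemma lt_rowLen_of_lt_diagonalLength (hi : i < diagonalLength μ) : i < μ.rowLen i :=
  YoungDiagram.mem_iff_lt_rowLen.1 (diag_mem_iff.2 hi)

lemma lt_colLen_of_lt_diagonalLength (hi : i < diagonalLength μ) : i < μ.colLen i :=
  YoungDiagram.mem_iff_lt_colLen.1 (diag_mem_iff.2 hi)

end

/-- The union of the hooks with corners `(i, i)` whose arm and leg lengths are the entries of the
`i`-th column of a two-rowed array. -/
def hookUnion (L : List (ℕ × ℕ)) : Finset (ℕ × ℕ) :=
  univ.biUnion fun i : Fin L.length ↦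
    ({↑i} ×ˢ Icc ↑i (i + L[i].1)) ∪ (Ioc ↑i (i + L[i].2) ×ˢ {↑i})

lemma arm_mem_hookUnion {L : List (ℕ × ℕ)} {i x : ℕ} :
    (i, i + x) ∈ hookUnion L ↔ ∃ h : i < L.length, x ≤ L[i].1 := by
  simp only [hookUnion, mem_biUnion, mem_union, mem_product, mem_singleton, mem_Icc, mem_Ioc,
    Fin.exists_iff, Fin.getElem_fin]
  grind

lemma leg_mem_hookUnion {L : List (ℕ × ℕ)} {i y : ℕ} :
    (i + y, i) ∈ hookUnion L ↔ ∃ h : i < L.length, y ≤ L[i].2 := by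
  simp only [hookUnion, mem_biUnion, mem_union, mem_product, mem_singleton, mem_Icc, mem_Ioc,
    Fin.exists_iff, Fin.getElem_fin]
  grind

lemma hookUnion_injective : Function.Injective hookUnion := by
  intro L M h
  have harm : ∀ i x, (∃ h : i < L.length, x ≤ L[i].1) ↔ ∃ h : i < M.length, x ≤ M[i].1 := by
    simp only [← arm_mem_hookUnion, h, implies_true]
  have hleg : ∀ i y, (∃ h : i < L.length, y ≤ L[i].2) ↔ ∃ h : i < M.length, y ≤ M[i].2 := by
    simp only [← leg_mem_hookUnion, h, implies_true]
  have hlen : L.length = M.length :=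
    eq_of_forall_lt_iff fun i ↦ by simpa using harm i 0
  refine List.ext_getElem hlen fun i hL hM ↦ Prod.ext ?_ ?_
  · exact eq_of_forall_le_iff fun x ↦ by simpa [hL, hM] using harm i x
  · exact eq_of_forall_le_iff fun y ↦ by simpa [hL, hM] using hleg i y

lemma card_hookUnion (L : List (ℕ × ℕ)) :
    #(hookUnion L) = (L.map fun c ↦ c.1 + c.2 + 1).sum := by
  have hhook : ∀ i x y : ℕ, #(({i} ×ˢ Icc i (i + x)) ∪ (Ioc i (i + y) ×ˢ {i})) = x + y + 1 := by
    intro i x y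
    rw [card_union_of_disjoint]
    · simp only [card_product, card_singleton, Nat.card_Icc, Nat.card_Ioc]
      omega
    · rw [disjoint_left]
      rintro ⟨a, b⟩
      simp only [mem_product, mem_singleton, mem_Icc, mem_Ioc]
      omega
  rw [hookUnion, card_biUnion]
  · simp only [hhook, Fin.getElem_fin]
    rw [← Fin.sum_univ_fun_getElem]
  · rintro ⟨i, hi⟩ - ⟨j, hj⟩ - hij
    rw [Function.onFun, disjoint_left]
    rintro ⟨a, b⟩
    simp only [mem_union, mem_product, mem_singleton, mem_Icc, mem_Ioc]
    simp only [ne_eq, Fin.mk.injEq] at hij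
    omega

lemma hookUnion_frobeniusSymbol (μ : YoungDiagram) :
    hookUnion (frobeniusSymbol μ) = μ.cells := by
  ext ⟨a, b⟩
  rw [YoungDiagram.mem_cells]
  obtain ⟨x, rfl⟩ | ⟨y, rfl⟩ := (le_total a b).imp Nat.exists_eq_add_of_le Nat.exists_eq_add_of_le
  · have hdiag : (a, a + x) ∈ μ → a < diagonalLength μ := fun h ↦
      diag_mem_iff.1 (μ.up_left_mem le_rfl (Nat.le_add_right a x) h)
    have := lt_rowLen_of_lt_diagonalLength (μ := μ) (i := a)
    rw [YoungDiagram.mem_iff_lt_rowLen] at hdiag ⊢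
    simp only [arm_mem_hookUnion, frobeniusSymbol, List.length_map, List.length_range,
      List.getElem_map, List.getElem_range, exists_prop]
    omega
  · have hdiag : (b + y, b) ∈ μ → b < diagonalLength μ := fun h ↦
      diag_mem_iff.1 (μ.up_left_mem (Nat.le_add_right b y) le_rfl h)
    have := lt_colLen_of_lt_diagonalLength (μ := μ) (i := b)
    rw [YoungDiagram.mem_iff_lt_colLen] at hdiag ⊢
    simp only [leg_mem_hookUnion, frobeniusSymbol, List.length_map, List.length_range,
      List.getElem_map, List.getElem_range, exists_prop]
    omega

lemma frobeniusSymbol_injective : Function.Injective frobeniusSymbol := fun μ ν h ↦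
  YoungDiagram.ext (by rw [← hookUnion_frobeniusSymbol, h, hookUnion_frobeniusSymbol])

/-- Both rows of a two-rowed array are strictly decreasing. -/
def StrictlyDecreasing (L : List (ℕ × ℕ)) : Prop :=
  L.Pairwise fun c c' ↦ c'.1 < c.1 ∧ c'.2 < c.2

lemma strictlyDecreasing_frobeniusSymbol (μ : YoungDiagram) :
    StrictlyDecreasing (frobeniusSymbol μ) := by
  rw [StrictlyDecreasing, frobeniusSymbol, List.pairwise_map]
  refine List.Pairwise.imp_of_mem ?_ (List.pairwise_lt_range (n := diagonalLength μ))
  intro a b _ hb hab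
  have := μ.rowLen_anti a b hab.le
  have := μ.colLen_anti a b hab.le
  have := lt_rowLen_of_lt_diagonalLength (List.mem_range.1 hb)
  have := lt_colLen_of_lt_diagonalLength (List.mem_range.1 hb)
  omega

lemma StrictlyDecreasing.add_le_add {L : List (ℕ × ℕ)} (hL : StrictlyDecreasing L) {i j : ℕ}
    (hij : i ≤ j) (hj : j < L.length) :
    j + L[j].1 ≤ i + L[i].1 ∧ j + L[j].2 ≤ i + L[i].2 := by
  induction j, hij using Nat.le_induction with
  | base => exact ⟨le_rfl, le_rfl⟩
  | succ j hij ih =>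
    have := ih (by omega)
    have := List.pairwise_iff_getElem.1 hL j (j + 1) (by omega) hj j.lt_succ_self
    omega

lemma StrictlyDecreasing.isLowerSet_hookUnion {L : List (ℕ × ℕ)} (hL : StrictlyDecreasing L) :
    IsLowerSet (hookUnion L : Set (ℕ × ℕ)) := by
  rintro ⟨a, b⟩ ⟨a', b'⟩ ⟨ha, hb⟩ h
  simp only at ha hb
  rw [mem_coe] at h ⊢
  obtain ⟨m, hm, hmL, hrow, hcol⟩ : ∃ m, ∃ hm : m < L.length, min a b = m ∧
      b ≤ m + L[m].1 ∧ a ≤ m + L[m].2 := by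
    obtain ⟨x, rfl⟩ | ⟨y, rfl⟩ :=
      (le_total a b).imp Nat.exists_eq_add_of_le Nat.exists_eq_add_of_le
    · obtain ⟨hm, hx⟩ := arm_mem_hookUnion.1 h
      exact ⟨a, hm, by omega, by omega, by omega⟩
    · obtain ⟨hm, hy⟩ := leg_mem_hookUnion.1 h
      exact ⟨b, hm, by omega, by omega, by omega⟩
  obtain ⟨x, rfl⟩ | ⟨y, rfl⟩ :=
    (le_total a' b').imp Nat.exists_eq_add_of_le Nat.exists_eq_add_of_le
  · have := hL.add_le_add (i := a') (j := m) (by omega) hm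
    exact arm_mem_hookUnion.2 ⟨by omega, by omega⟩
  · have := hL.add_le_add (i := b') (j := m) (by omega) hm
    exact leg_mem_hookUnion.2 ⟨by omega, by omega⟩

lemma exists_frobeniusSymbol_eq_iff {L : List (ℕ × ℕ)} :
    (∃ μ, frobeniusSymbol μ = L) ↔ StrictlyDecreasing L := by
  constructor
  · rintro ⟨μ, rfl⟩
    exact strictlyDecreasing_frobeniusSymbol μ
  · intro hL
    exact ⟨⟨hookUnion L, hL.isLowerSet_hookUnion⟩,
      hookUnion_injective (hookUnion_frobeniusSymbol _)⟩

lemma card_cells_eq_sum_frobeniusSymbol (μ : YoungDiagram) :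
    #μ.cells = ((frobeniusSymbol μ).map fun c ↦ c.1 + c.2 + 1).sum := by
  rw [← card_hookUnion, hookUnion_frobeniusSymbol]

lemma card_cells_ofRowLens (w : List ℕ) (hw : w.SortedGE) :
    #(YoungDiagram.ofRowLens w hw).cells = w.sum := by
  change #(YoungDiagram.cellsOfRowLens w) = w.sum
  clear hw
  induction w with
  | nil => rfl
  | cons a w ih =>
    rw [YoungDiagram.cellsOfRowLens, card_union_of_disjoint, card_map, ih, List.sum_cons]
    · simp
    · rw [disjoint_left]
      rintro ⟨i, j⟩ h
      simp only [mem_product, mem_singleton, mem_range] at h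
      simp [h.1]

lemma card_cells_ferrersGraph {n : ℕ} (p : n.Partition) : #(ferrersGraph p).cells = n := by
  rw [ferrersGraph, card_cells_ofRowLens, ← Multiset.sum_coe, Multiset.sort_eq, p.parts_sum]

lemma ferrersGraph_injective (n : ℕ) :
    Function.Injective (ferrersGraph : n.Partition → YoungDiagram) := by
  have hrowLens : ∀ p : n.Partition, ((ferrersGraph p).rowLens : Multiset ℕ) = p.parts := by
    intro p
    rw [ferrersGraph, YoungDiagram.rowLens_ofRowLens_eq_self fun _ hx ↦
      p.parts_pos ((Multiset.mem_sort _).1 hx), Multiset.sort_eq]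
  intro p q h
  ext1
  rw [← hrowLens, h, hrowLens]

lemma exists_ferrersGraph_eq_iff {n : ℕ} {μ : YoungDiagram} :
    (∃ p : n.Partition, ferrersGraph p = μ) ↔ #μ.cells = n := by
  constructor
  · rintro ⟨p, rfl⟩
    exact card_cells_ferrersGraph p
  · rintro rfl
    have hμ : YoungDiagram.ofRowLens μ.rowLens μ.rowLens_sorted = μ :=
      YoungDiagram.ofRowLens_to_rowLens_eq_self
    refine ⟨⟨μ.rowLens, fun hi ↦ μ.pos_of_mem_rowLens _ (Multiset.mem_coe.1 hi), ?_⟩, ?_⟩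
    · rw [Multiset.sum_coe, ← card_cells_ofRowLens _ μ.rowLens_sorted, hμ]
    · have hsort : (μ.rowLens : Multiset ℕ).sort (· ≥ ·) = μ.rowLens := by
        rw [Multiset.coe_sort]
        exact List.mergeSort_of_pairwise (by simpa using μ.rowLens_sorted.pairwise)
      simp only [ferrersGraph, hsort, hμ]

lemma exists_frobeniusSymbol_ferrersGraph_iff {n : ℕ} {L : List (ℕ × ℕ)} :
    (∃ p : n.Partition, frobeniusSymbol (ferrersGraph p) = L) ↔
      StrictlyDecreasing L ∧ (L.map fun c ↦ c.1 + c.2 + 1).sum = n := by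
  rw [← exists_frobeniusSymbol_eq_iff]
  constructor
  · rintro ⟨p, rfl⟩
    exact ⟨⟨_, rfl⟩, by rw [← card_cells_eq_sum_frobeniusSymbol, card_cells_ferrersGraph]⟩
  · rintro ⟨⟨μ, rfl⟩, hμ⟩
    rw [← card_cells_eq_sum_frobeniusSymbol] at hμ
    obtain ⟨p, rfl⟩ := exists_ferrersGraph_eq_iff.2 hμ
    exact ⟨p, rfl⟩

/-! ### Frobenius symbols as pairs of charge zero -/

section

variable {p : Finset ℕ × Finset ℕ}

lemma map_fst_columns (hp : charge p = 0) : (columns p).map Prod.fst = p.1.sort.reverse := by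
  have : #p.1 = #p.2 := by simpa [charge, sub_eq_zero] using hp
  rw [columns, List.map_reverse, List.map_fst_zip (by simp [this])]

lemma map_snd_columns (hp : charge p = 0) : (columns p).map Prod.snd = p.2.sort.reverse := by
  have : #p.1 = #p.2 := by simpa [charge, sub_eq_zero] using hp
  rw [columns, List.map_reverse, List.map_snd_zip (by simp [this])]

lemma columns_injOn : Set.InjOn columns {p | charge p = 0} := by
  have hX : ∀ p, charge p = 0 → ((columns p).map Prod.fst).toFinset = p.1 := fun p hp ↦ by
    rw [map_fst_columns hp, List.toFinset_reverse, sort_toFinset]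
  have hY : ∀ p, charge p = 0 → ((columns p).map Prod.snd).toFinset = p.2 := fun p hp ↦ by
    rw [map_snd_columns hp, List.toFinset_reverse, sort_toFinset]
  intro p hp q hq h
  exact Prod.ext (by rw [← hX p hp, h, hX q hq]) (by rw [← hY p hp, h, hY q hq])

lemma strictlyDecreasing_iff {L : List (ℕ × ℕ)} :
    StrictlyDecreasing L ↔ (L.map Prod.fst).SortedGT ∧ (L.map Prod.snd).SortedGT := by
  rw [StrictlyDecreasing, List.pairwise_and_iff, List.sortedGT_iff_pairwise,
    List.sortedGT_iff_pairwise, List.pairwise_map, List.pairwise_map]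

lemma strictlyDecreasing_columns (hp : charge p = 0) : StrictlyDecreasing (columns p) := by
  rw [strictlyDecreasing_iff, map_fst_columns hp, map_snd_columns hp]
  exact ⟨p.1.sortedLT_sort.reverse, p.2.sortedLT_sort.reverse⟩

lemma sum_columns (hp : charge p = 0) :
    (((columns p).map fun c ↦ c.1 + c.2 + 1).sum : ℕ) = pairWeight p := by
  have hsum : ∀ (X : Finset ℕ) (f : ℕ → ℤ), (X.sort.reverse.map f).sum = ∑ x ∈ X, f x := by
    intro X f
    rw [List.map_reverse, List.sum_reverse, ← List.sum_toFinset _ (sort_nodup _ _), sort_toFinset]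
  simp only [pairWeight, ← hsum, ← map_fst_columns hp, ← map_snd_columns hp, List.map_map,
    ← List.sum_map_add, Nat.cast_list_sum]
  congr 2

lemma StrictlyDecreasing.exists_columns_eq {L : List (ℕ × ℕ)} (hL : StrictlyDecreasing L) :
    ∃ p, charge p = 0 ∧ columns p = L := by
  have hsort : ∀ M : List ℕ, M.SortedGT → M.toFinset.sort = M.reverse := fun M hM ↦ by
    rw [← List.toFinset_reverse]
    exact (List.toFinset_sort (· ≤ ·) hM.reverse.nodup).2 hM.reverse.sortedLE.pairwise
  obtain ⟨hX, hY⟩ := strictlyDecreasing_iff.1 hL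
  refine ⟨((L.map Prod.fst).toFinset, (L.map Prod.snd).toFinset), ?_, ?_⟩
  · rw [charge, List.toFinset_card_of_nodup hX.nodup, List.toFinset_card_of_nodup hY.nodup]
    simp
  · rw [columns, hsort _ hX, hsort _ hY, ← List.map_reverse, ← List.map_reverse, List.zip_map',
      List.map_id', List.reverse_reverse]

lemma subset_range_of_pairWeight_lt {k : ℕ} (h : pairWeight p < k) :
    p.1 ⊆ range k ∧ p.2 ⊆ range k := by
  have hw : ((∑ x ∈ p.1, x + ∑ y ∈ p.2, (y + 1) : ℕ) : ℤ) < k := by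
    simpa [pairWeight] using h
  rw [Nat.cast_lt] at hw
  refine ⟨fun x hx ↦ mem_range.2 ?_, fun y hy ↦ mem_range.2 ?_⟩
  · have := single_le_sum (f := fun x ↦ x) (fun _ _ ↦ Nat.zero_le _) hx
    omega
  · have := single_le_sum (f := fun y ↦ y + 1) (fun _ _ ↦ Nat.zero_le _) hy
    omega

end

lemma image_columns_chargedPairs {n k : ℕ} (hk : n < k) :
    (chargedPairs k k 0 n).image columns =
      univ.image fun p : n.Partition ↦ frobeniusSymbol (ferrersGraph p) := by
  ext L
  simp only [mem_image, mem_univ, true_and, exists_frobeniusSymbol_ferrersGraph_iff,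
    mem_chargedPairs]
  constructor
  · rintro ⟨p, ⟨-, hp, hw⟩, rfl⟩
    exact ⟨strictlyDecreasing_columns hp, by exact_mod_cast (sum_columns hp).trans hw⟩
  · rintro ⟨hL, hn⟩
    obtain ⟨p, hp, rfl⟩ := hL.exists_columns_eq
    have hw : pairWeight p = n := by rw [← sum_columns hp, hn]
    exact ⟨p, ⟨subset_range_of_pairWeight_lt (by omega), hp, hw⟩, rfl⟩

lemma card_filter_frobeniusSymbol {n k : ℕ} (hk : n < k) (P : List (ℕ × ℕ) → Prop)
    [DecidablePred P] :
    #{p : n.Partition | P (frobeniusSymbol (ferrersGraph p))} =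
      #{q ∈ chargedPairs k k 0 n | P (columns q)} := by
  have hinj : Set.InjOn columns (chargedPairs k k 0 n) :=
    columns_injOn.mono fun p hp ↦ (mem_chargedPairs.1 hp).2.1
  have hinj' : Function.Injective fun p : n.Partition ↦ frobeniusSymbol (ferrersGraph p) :=
    frobeniusSymbol_injective.comp (ferrersGraph_injective n)
  rw [← card_image_of_injOn (hinj.mono (filter_subset _ _)),
    ← card_image_of_injective _ hinj', ← filter_image, ← filter_image,
    image_columns_chargedPairs hk]

/-! ### Pentagonal numbers -/

lemma partitionCount_of_neg {k : ℤ} (hk : k < 0) : partitionCount k = 0 := if_neg (not_le.2 hk)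

lemma partitionCount_natCast (n : ℕ) : partitionCount n = Fintype.card n.Partition := by
  simp [partitionCount]

lemma pairCount_of_neg (k l : ℕ) (d : ℤ) {n : ℤ} (hn : n < 0) : pairCount k l d n = 0 := by
  rw [pairCount, card_eq_zero, eq_empty_iff_forall_notMem]
  intro p hp
  exact (pairWeight_nonneg p).not_gt ((mem_chargedPairs.1 hp).2.2.trans_lt hn)

lemma pairCount_charge_zero {k : ℕ} {n : ℤ} (hk : n < k) :
    (pairCount k k 0 n : ℤ) = partitionCount n := by
  obtain hn | hn := lt_or_ge n 0
  · rw [pairCount_of_neg _ _ _ hn, partitionCount_of_neg hn, Nat.cast_zero]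
  · lift n to ℕ using hn
    have h := card_filter_frobeniusSymbol (Nat.cast_lt.1 hk) fun _ ↦ True
    simpa [partitionCount_natCast, pairCount, ← card_univ] using h.symm

lemma pairCount_succ_charge {k : ℕ} {d n : ℤ} (hn : n ≤ k) (hnd : n + d < k) :
    pairCount k k d n = pairCount k k (d + 1) (n + d) := by
  have h := pairCount_shift k k d n
  rwa [pairCount_succ_right, pairCount_succ_left, pairCount_of_neg k k _ (n := n - _) (by omega),
    pairCount_of_neg k k _ (n := n + d - _) (by omega)] at h

/-- The triangular number `t` is the least weight of a pair of charge `d`. -/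
lemma pairCount_eq_partitionCount {k : ℕ} {d n t : ℤ} (hk : n < k) (ht : 2 * t = d * (d - 1)) :
    (pairCount k k d n : ℤ) = partitionCount (n - t) := by
  induction d generalizing n t with
  | zero =>
    obtain rfl : t = 0 := by simpa using ht
    rw [pairCount_charge_zero hk, sub_zero]
  | succ d ih =>
    have h := pairCount_succ_charge (k := k) (d := d) (n := n - d) (by omega) (by omega)
    rw [sub_add_cancel] at h
    rw [← h, ih (t := t - d) (by omega) (by linear_combination ht)]
    ring_nf
  | pred d ih =>
    rw [pairCount_succ_charge hk.le (by omega), sub_add_cancel,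
      ih (t := t + (-d - 1)) (by omega) (by linear_combination ht)]
    ring_nf

lemma two_mul_reflectedCharge (j : ℕ) (δ : Bool) :
    2 * reflectedCharge j (startSign j δ) =
      (if startSign j δ then 3 * (j : ℤ) else -(3 * j)) + if startSign j δ = δ then 1 else 0 := by
  induction j with
  | zero => simp [reflectedCharge, startSign]
  | succ j ih =>
    rw [startSign]
    cases h : startSign j δ <;> cases δ <;> grind [reflectedCharge]

/-- The pentagonal number that is attached to the alternating word of length `j` ending with `δ`. -/
def signedPentagonal (j : ℕ) (δ : Bool) : ℕ := pentagonal (if δ then -j else j)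

lemma two_mul_signedPentagonal (j : ℕ) (δ : Bool) :
    2 * (signedPentagonal j δ : ℤ) = j * (3 * j + if δ then 1 else -1) := by
  rw [signedPentagonal, two_mul_natCast_pentagonal]
  split_ifs <;> ring

lemma two_mul_signedPentagonal_sub_reflectedShift (j : ℕ) (δ : Bool) :
    2 * (signedPentagonal j δ - reflectedShift j (startSign j δ)) =
      reflectedCharge j (startSign j δ) * (reflectedCharge j (startSign j δ) - 1) := by
  rw [mul_sub, two_mul_signedPentagonal]
  induction j with
  | zero => simp [reflectedCharge, reflectedShift]
  | succ j ih =>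
    have hc := two_mul_reflectedCharge j δ
    rw [startSign]
    cases h : startSign j δ <;> cases δ <;> grind [reflectedCharge, reflectedShift]

lemma card_filter_le_oscillation (n j : ℕ) (δ : Bool) :
    (#{p : n.Partition | j ≤ oscillation (startSign j δ)
        ((frobeniusSymbol (ferrersGraph p)).map columnSign)} : ℤ) =
      partitionCount (n - signedPentagonal j δ) := by
  set s := reflectedShift j (startSign j δ)
  set k := n + s.natAbs + 1
  rw [card_filter_frobeniusSymbol (k := k) (by omega)
    fun L ↦ j ≤ oscillation (startSign j δ) (L.map columnSign)]
  have h := reflectsAt_self k 0 n j (startSign j δ) (by simp)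
  rw [zero_add] at h
  change ((oscillationCount k k 0 n j (startSign j δ) : ℕ) : ℤ) = _
  rw [h, pairCount_eq_partitionCount (by omega) (two_mul_signedPentagonal_sub_reflectedShift j δ)]
  ring_nf

/-! ### Parity blocks -/

lemma columnPositive_iff (c : ℕ × ℕ) : ColumnPositive c ↔ columnSign c = true := by
  simp only [ColumnPositive, columnSign, decide_eq_true_eq]
  omega

lemma columnNegative_iff (c : ℕ × ℕ) : ColumnNegative c ↔ columnSign c = false := by
  simp only [ColumnNegative, columnSign, decide_eq_false_iff_not]
  omega

lemma sameParity_iff (c c' : ℕ × ℕ) : SameParity c c' ↔ columnSign c = columnSign c' := by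
  simp only [SameParity, columnPositive_iff, columnNegative_iff]
  cases columnSign c <;> cases columnSign c' <;> simp

/-- The common sign of the columns of a parity block. -/
def blockSign (B : List (ℕ × ℕ)) : Bool := B.all columnSign

/-- The signs of the parity blocks of a partition, from left to right. -/
def blockSigns {n : ℕ} (p : n.Partition) : List Bool := (parityBlocks p).map blockSign

section

variable {n : ℕ} (p : n.Partition)

lemma columnSign_eq_blockSign {B : List (ℕ × ℕ)} (hB : B ∈ parityBlocks p) {c : ℕ × ℕ}
    (hc : c ∈ B) : columnSign c = blockSign B := by
  have hconst : (B.map columnSign).IsChain (· = ·) := by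
    have := List.isChain_of_mem_splitBy hB
    simpa only [List.isChain_map, decide_eq_true_eq, sameParity_iff] using this
  have hpair : ∀ c ∈ B, ∀ c' ∈ B, columnSign c = columnSign c' := fun c hc c' hc' ↦
    (List.isChain_iff_pairwise.1 hconst).forall_of_forall (fun _ _ ↦ rfl)
      (List.mem_map_of_mem hc) (List.mem_map_of_mem hc')
  rw [blockSign, Bool.eq_iff_iff, List.all_eq_true]
  exact ⟨fun h c' hc' ↦ hpair c' hc' c hc ▸ h, fun h ↦ h c hc⟩

lemma blockSign_eq_iff {B : List (ℕ × ℕ)} (hB : B ∈ parityBlocks p) (δ : Bool) :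
    blockSign B = δ ↔ ∀ c ∈ B, columnSign c = δ := by
  obtain ⟨c, hc⟩ := List.exists_mem_of_ne_nil B (List.ne_nil_of_mem_splitBy hB)
  constructor
  · rintro rfl c hc
    exact columnSign_eq_blockSign p hB hc
  · intro h
    rw [← columnSign_eq_blockSign p hB hc, h c hc]

lemma isChain_blockSigns : (blockSigns p).IsChain (· ≠ ·) := by
  rw [blockSigns, List.isChain_map]
  refine List.IsChain.imp_of_mem_imp ?_ (List.isChain_getLast_head_splitBy _ _)
  rintro A B hA hB ⟨ha, hb, hab⟩
  rwa [decide_eq_false_iff_not, sameParity_iff, columnSign_eq_blockSign p hA (List.getLast_mem ha),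
    columnSign_eq_blockSign p hB (List.head_mem hb)] at hab

lemma oscillation_blockSigns (e : Bool) :
    oscillation e ((frobeniusSymbol (ferrersGraph p)).map columnSign) =
      oscillation e (blockSigns p) := by
  have hflatten : (parityBlocks p).flatten = frobeniusSymbol (ferrersGraph p) :=
    List.flatten_splitBy _ _
  rw [← hflatten, blockSigns]
  exact oscillation_flatten (List.nil_notMem_splitBy _ _)
    (fun B hB c hc ↦ columnSign_eq_blockSign p hB hc) e

lemma blockSigns_eq_nil_iff : blockSigns p = [] ↔ n = 0 := by
  have hn : ((frobeniusSymbol (ferrersGraph p)).map fun c ↦ c.1 + c.2 + 1).sum = n :=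
    (exists_frobeniusSymbol_ferrersGraph_iff.1 ⟨p, rfl⟩).2
  rw [blockSigns, List.map_eq_nil_iff, parityBlocks, List.splitBy_eq_nil]
  cases h : frobeniusSymbol (ferrersGraph p) <;> simp [h, ← hn]

lemma getLast?_blockSigns_eq_some_iff (δ : Bool) :
    (blockSigns p).getLast? = some δ ↔
      ∃ B ∈ (parityBlocks p).getLast?, ∀ c ∈ B, columnSign c = δ := by
  rw [blockSigns, List.getLast?_map, Option.map_eq_some_iff]
  exact exists_congr fun B ↦ and_congr_right fun hB ↦
    blockSign_eq_iff p (List.mem_of_getLast? hB) δ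

end

/-- The number of partitions of `n` with `m` parity blocks of which the last, if there is one, has
sign `δ`. The empty partition is counted for `m = 0`. -/
def blockCount (m n : ℕ) (δ : Bool) : ℕ :=
  #{p : n.Partition | (blockSigns p).length = m ∧ (blockSigns p).getLastD δ = δ}

lemma card_getLast?_eq_blockCount (m n : ℕ) (δ : Bool) :
    Nat.card {p : n.Partition // (parityBlocks p).length = m + 1 ∧
      ∃ B ∈ (parityBlocks p).getLast?, ∀ c ∈ B, columnSign c = δ} = blockCount (m + 1) n δ := by
  classical
  rw [Nat.card_eq_fintype_card, Fintype.card_subtype, blockCount]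
  congr 1
  refine filter_congr fun p _ ↦ ?_
  rw [← getLast?_blockSigns_eq_some_iff, ← List.length_map (as := parityBlocks p) blockSign,
    ← blockSigns, List.getLastD_eq_getLast?]
  refine and_congr_right fun h ↦ ?_
  have : blockSigns p ≠ [] := List.ne_nil_of_length_eq_add_one h
  simp [List.getLast?_eq_some_getLast this]

lemma aPos_succ (m n : ℕ) : aPos (m + 1) n = blockCount (m + 1) n true := by
  simp only [aPos, LastBlockPositive, columnPositive_iff, card_getLast?_eq_blockCount]

lemma aNeg_succ (m n : ℕ) : aNeg (m + 1) n = blockCount (m + 1) n false := by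
  simp only [aNeg, LastBlockNegative, columnNegative_iff, card_getLast?_eq_blockCount]

lemma blockCount_zero_left (n : ℕ) (δ : Bool) : blockCount 0 n δ = if n = 0 then 1 else 0 := by
  have h : ∀ p : n.Partition,
      (blockSigns p).length = 0 ∧ (blockSigns p).getLastD δ = δ ↔ n = 0 := fun p ↦ by
    rw [List.length_eq_zero_iff, ← blockSigns_eq_nil_iff p, and_iff_left_iff_imp]
    intro hp
    rw [hp, List.getLastD_nil]
  simp only [blockCount, h]
  split_ifs with hn
  · subst hn
    simp
  · simp [hn]

lemma blockCount_succ_zero (m : ℕ) (δ : Bool) : blockCount (m + 1) 0 δ = 0 := by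
  simp only [blockCount, (blockSigns_eq_nil_iff _).2]
  simp

lemma blockCount_add_blockCount_succ (l n : ℕ) (δ : Bool) :
    (blockCount l n δ + blockCount (l + 1) n δ : ℤ) =
      partitionCount (n - signedPentagonal l δ) -
        partitionCount (n - signedPentagonal (l + 1) !δ) := by
  rw [← card_filter_le_oscillation, ← card_filter_le_oscillation, startSign_succ_not,
    eq_sub_iff_add_eq]
  simp only [oscillation_blockSigns, blockCount]
  norm_cast
  rw [← card_union_of_disjoint, ← filter_or, ← card_union_of_disjoint, ← filter_or]
  · congr 1
    refine filter_congr fun p _ ↦ ?_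
    have := oscillation_startSign_eq_iff (isChain_blockSigns p) l δ
    grind
  · rw [disjoint_filter]
    intro p _
    have := oscillation_startSign_eq_iff (isChain_blockSigns p) l δ
    grind
  · rw [disjoint_filter]
    grind

/-! ### Alternating sums and generating functions -/

lemma eq_alternating_sum {R : Type*} [CommRing R] (a : ℕ → R) (m : ℕ) :
    a m = (-1) ^ m * (a 0 - ∑ l ∈ range m, (-1) ^ l * (a l + a (l + 1))) := by
  have hterm : ∀ l, (-1) ^ l * (a l + a (l + 1)) =
      (-1) ^ l * a l - (-1) ^ (l + 1) * a (l + 1) := fun l ↦ by ring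
  simp only [hterm, sum_range_sub' fun l ↦ (-1) ^ l * a l]
  rw [pow_zero, one_mul, sub_sub_cancel, ← mul_assoc, ← mul_pow, neg_one_mul, neg_neg, one_pow,
    one_mul]

lemma blockCount_succ_eq {n : ℕ} (hn : 1 ≤ n) (m : ℕ) (δ : Bool) :
    (blockCount (m + 1) n δ : ℤ) = (-1) ^ m * ∑ l ∈ range (m + 1), (-1) ^ l *
      (partitionCount (n - signedPentagonal l δ) -
        partitionCount (n - signedPentagonal (l + 1) !δ)) := by
  rw [eq_alternating_sum (fun l ↦ (blockCount l n δ : ℤ)), blockCount_zero_left,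
    if_neg (Nat.one_le_iff_ne_zero.1 hn)]
  simp only [blockCount_add_blockCount_succ]
  ring

lemma signedPentagonal_succ_not (l : ℕ) (δ : Bool) :
    signedPentagonal (l + 1) (!δ) = signedPentagonal l δ + if δ then 2 * l + 1 else 4 * l + 2 := by
  have h := two_mul_signedPentagonal l δ
  have h' := two_mul_signedPentagonal (l + 1) !δ
  cases δ <;> grind

lemma signedPentagonal_true (l : ℕ) : signedPentagonal l true = l * (3 * l + 1) / 2 := by
  have h := two_mul_signedPentagonal l true
  rw [if_pos rfl] at h
  norm_cast at h
  omega

lemma signedPentagonal_false (l : ℕ) : signedPentagonal l false = l * (3 * l - 1) / 2 := by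
  have h := two_mul_signedPentagonal l false
  obtain rfl | hl := l.eq_zero_or_pos
  · simpa using h
  · rw [if_neg Bool.false_ne_true, ← sub_eq_add_neg,
      show 3 * (l : ℤ) - 1 = (3 * l - 1 : ℕ) by omega] at h
    norm_cast at h
    omega

lemma natCast_signedPentagonal (l : ℕ) (δ : Bool) :
    (signedPentagonal l δ : ℤ) =
      if δ then (3 * (l : ℤ) ^ 2 + l) / 2 else (3 * (l : ℤ) ^ 2 - l) / 2 := by
  have h := two_mul_signedPentagonal l δ
  split_ifs at h ⊢ <;> refine Int.eq_ediv_of_mul_eq_right two_ne_zero (h.trans ?_) <;> ring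

open PowerSeries

/-- The generating function `∑ p(n) q ^ n` of the partition function. -/
noncomputable def partitionSeries : ℚ⟦X⟧ := mk fun n ↦ (partitionCount n : ℚ)

open scoped PowerSeries.WithPiTopology in
lemma partitionSeries_mul_qqInfinity : partitionSeries * qqInfinity = 1 := by
  have hmk : partitionSeries =
      mk fun n ↦ (#(Nat.Partition.restricted n fun _ ↦ True) : ℚ) := by
    ext n
    simp [partitionSeries, partitionCount_natCast, Nat.Partition.restricted]
  have hgeom : ∀ i : ℕ, (if True then ∑' j : ℕ, (X : ℚ⟦X⟧) ^ ((i + 1) * j) else 1) *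
      (1 - X ^ (i + 1)) = 1 := fun i ↦ by
    simp_rw [if_true, pow_mul]
    exact WithPiTopology.tsum_pow_mul_one_sub_of_constantCoeff_eq_zero (by simp)
  have hprod := (Nat.Partition.hasProd_powerSeriesMk_card_restricted ℚ fun _ ↦ True).mul
    (WithPiTopology.multipliable_one_sub_X_pow ℚ).hasProd
  simp only [hgeom] at hprod
  rw [hmk]
  exact hprod.unique hasProd_one

lemma inv_qqInfinity : qqInfinity⁻¹ = partitionSeries := by
  have h := partitionSeries_mul_qqInfinity
  rw [eq_comm, PowerSeries.eq_inv_iff_mul_eq_one, h]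
  intro h0
  simpa [h0] using congrArg constantCoeff h

lemma coeff_partitionSeries_mul_X_pow (n a : ℕ) :
    coeff n (partitionSeries * X ^ a) = (partitionCount (n - a) : ℚ) := by
  rw [coeff_mul_X_pow']
  split_ifs with h
  · rw [partitionSeries, coeff_mk, Nat.cast_sub h]
  · rw [partitionCount_of_neg (by omega), Int.cast_zero]

lemma mk_blockCount_add_succ (l : ℕ) (δ : Bool) :
    (mk fun n ↦ (blockCount l n δ : ℚ)) + (mk fun n ↦ (blockCount (l + 1) n δ : ℚ)) =
      partitionSeries * (X ^ signedPentagonal l δ *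
        (1 - X ^ (if δ then 2 * l + 1 else 4 * l + 2))) := by
  ext n
  rw [mul_one_sub, ← pow_add, ← signedPentagonal_succ_not, mul_sub, map_sub,
    coeff_partitionSeries_mul_X_pow, coeff_partitionSeries_mul_X_pow, map_add, coeff_mk, coeff_mk]
  exact_mod_cast blockCount_add_blockCount_succ l n δ

lemma genSeries_blockCount (m : ℕ) (δ : Bool) :
    genSeries (fun n ↦ blockCount (m + 1) n δ) =
      (-1) ^ (m + 1) + (-1) ^ m * qqInfinity⁻¹ *
        ∑ l ∈ range (m + 1), (-1) ^ l * X ^ signedPentagonal l δ *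
          (1 - X ^ (if δ then 2 * l + 1 else 4 * l + 2)) := by
  have hgen : genSeries (fun n ↦ blockCount (m + 1) n δ) =
      mk fun n ↦ (blockCount (m + 1) n δ : ℚ) := by
    ext n
    cases n <;> simp [genSeries, blockCount_succ_zero]
  have hzero : (mk fun n ↦ (blockCount 0 n δ : ℚ)) = 1 := by
    ext n
    simp [blockCount_zero_left, coeff_one]
  rw [hgen, eq_alternating_sum (fun l ↦ mk fun n ↦ (blockCount l n δ : ℚ)), hzero, inv_qqInfinity]
  simp only [mk_blockCount_add_succ, mul_left_comm _ partitionSeries, ← mul_sum]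
  simp only [mul_assoc]
  ring

end ParityBlocks

theorem theorem1p2 (m : ℕ) (hm : 1 ≤ m) :
    -- the two generating functions, as formal power series in `q = X`
    ParityBlocks.genSeries (ParityBlocks.aPos m) =
        (-1) ^ m + (-1) ^ (m - 1) * (ParityBlocks.qqInfinity)⁻¹ *
          ∑ l ∈ Finset.range m, (-1) ^ l * PowerSeries.X ^ (l * (3 * l + 1) / 2) *
            (1 - PowerSeries.X ^ (2 * l + 1)) ∧
    ParityBlocks.genSeries (ParityBlocks.aNeg m) =
        (-1) ^ m + (-1) ^ (m - 1) * (ParityBlocks.qqInfinity)⁻¹ *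
          ∑ l ∈ Finset.range m, (-1) ^ l * PowerSeries.X ^ (l * (3 * l - 1) / 2) *
            (1 - PowerSeries.X ^ (4 * l + 2)) ∧
    -- the two formulas in terms of the partition function
    (∀ n : ℕ, 1 ≤ n →
      (ParityBlocks.aPos m n : ℤ) = (-1) ^ (m - 1) * ∑ l ∈ Finset.range m, (-1) ^ l *
        (ParityBlocks.partitionCount (n - (3 * (l : ℤ) ^ 2 + l) / 2) -
          ParityBlocks.partitionCount (n - (3 * ((l : ℤ) + 1) ^ 2 - (l + 1)) / 2))) ∧
    (∀ n : ℕ, 1 ≤ n →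
      (ParityBlocks.aNeg m n : ℤ) = (-1) ^ (m - 1) * ∑ l ∈ Finset.range m, (-1) ^ l *
        (ParityBlocks.partitionCount (n - (3 * (l : ℤ) ^ 2 - l) / 2) -
          ParityBlocks.partitionCount (n - (3 * ((l : ℤ) + 1) ^ 2 + (l + 1)) / 2))) := by
  obtain ⟨m, rfl⟩ := Nat.exists_eq_add_of_le' hm
  rw [Nat.add_sub_cancel, funext (ParityBlocks.aPos_succ m), funext (ParityBlocks.aNeg_succ m)]
  refine ⟨?_, ?_, fun n hn ↦ ?_, fun n hn ↦ ?_⟩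
  · simpa [ParityBlocks.signedPentagonal_true] using ParityBlocks.genSeries_blockCount m true
  · simpa [ParityBlocks.signedPentagonal_false] using ParityBlocks.genSeries_blockCount m false
  · simpa [ParityBlocks.natCast_signedPentagonal] using ParityBlocks.blockCount_succ_eq hn m true
  · simpa [ParityBlocks.natCast_signedPentagonal] using ParityBlocks.blockCount_succ_eq hn m false
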